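/- Let $d\ge 0$ and $N\ge 1$ be integers, and let $H$ be an $N$-band Bloch Hamiltonian in $d$ dimensions, i.e. an $N\times N$-matrix-valued function $H(\mathbf z)$ of $\mathbf z=(z_1,\dots,z_d)$ whose entries are analytic on $(\mathbb C\setminus\{0\})^d$ (for example Laurent polynomials, as for finite-range hopping). Let $$\Sigma_{\mathrm{PBC}}=\{E\in\mathbb C:\ \det(E-H(\mathbf z))=0\text{ for some }\mathbf z\text{ with }|z_1|=\dots=|z_d|=1\}.$$ For $E\in\mathbb C$ let the amoeba be $$\mathcal A_E=\{\boldsymbol\mu\in\mathbb R^d:\ \det(E-H(e^{\boldsymbol\mu+i\boldsymbol\theta}))=0\text{ for some }\boldsymbol\theta\in\mathbb R^d\},\qquad e^{\boldsymbol\mu+i\boldsymbol\theta}=(e^{\mu_1+i\theta_1},\dots,e^{\mu_d+i\theta_d}),$$ let the Ronkin function be $$R_E(\boldsymbol\mu)=\frac1{(2\pi)^d}\int_{[0,2\pi]^d}\log\bigl|\det(E-H(e^{\boldsymbol\mu+i\boldsymbol\theta}))\bigr|\,\mathrm d^d\boldsymbol\theta ,$$ and call a connected component of $\mathbb R^d\setminus\mathcal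 A_E$ on which $R_E$ is constant a central hole of $\mathcal A_E$. Then $\max_{E'\in\Sigma_{\mathrm{PBC}}}\mathrm{Im}\,E'$ exists, and for every $E\in\mathbb C$ with $\mathrm{Im}\,E>\max_{E'\in\Sigma_{\mathrm{PBC}}}\mathrm{Im}\,E'$: 1. the point $\boldsymbol\mu=0$ lies in a central hole of $\mathcal A_E$; 2. $R_E$ is differentiable at $\boldsymbol\mu=0$ with $\nabla R_E(0)=0$; 3. for every $j\in\{1,\dots,d\}$ and all fixed values of the other angles, the function $\theta_j\mapsto\det(E-H(e^{i\boldsymbol\theta}))$ does not vanish on $[0,2\pi]$, and its winding number around $0$ as $\theta_j$ goes from $0$ to $2\pi$ is $0$. -/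

import Mathlib

noncomputable section

/-- The point `e^{μ + iθ} = (e^{μ₁ + iθ₁}, …, e^{μ_d + iθ_d})` of `(ℂ \ {0})^d`. -/
def expPoint {d : ℕ} (μ θ : Fin d → ℝ) : Fin d → ℂ :=
  fun i => Complex.exp ((μ i : ℂ) + (θ i : ℂ) * Complex.I)

/-- The characteristic function `det (E - H(z))` of a matrix-valued symbol `H`. -/
def charDet {d N : ℕ} (H : (Fin d → ℂ) → Matrix (Fin N) (Fin N) ℂ) (E : ℂ)
    (z : Fin d → ℂ) : ℂ :=
  (E • (1 : Matrix (Fin N) (Fin N) ℂ) - H z).det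

/-- `H` is an `N`-band Bloch Hamiltonian on a `d`-dimensional lattice: every matrix entry is an
analytic function of `z` on `{z ∈ ℂ^d | z_i ≠ 0 for all i}`. (For finite-range hopping the entries
are Laurent polynomials in the `z_i`.) -/
def IsBlochHamiltonian {d N : ℕ} (H : (Fin d → ℂ) → Matrix (Fin N) (Fin N) ℂ) : Prop :=
  ∀ a b, AnalyticOnNhd ℂ (fun z => H z a b) {z | ∀ i, z i ≠ 0}

/-- The spectrum under periodic boundary conditions: the energies `E` that are eigenvalues of
`H(z)` for some `z` in the Brillouin zone `|z₁| = … = |z_d| = 1`. -/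
def pbcSpectrum {d N : ℕ} (H : (Fin d → ℂ) → Matrix (Fin N) (Fin N) ℂ) : Set ℂ :=
  {E | ∃ z : Fin d → ℂ, (∀ i, ‖z i‖ = 1) ∧ charDet H E z = 0}

/-- The amoeba `A_E`: the set of all `log |z|` with `det (E - H(z)) = 0`, where all `z_i ≠ 0`. -/
def amoeba {d N : ℕ} (H : (Fin d → ℂ) → Matrix (Fin N) (Fin N) ℂ) (E : ℂ) :
    Set (Fin d → ℝ) :=
  {μ | ∃ θ : Fin d → ℝ, charDet H E (expPoint μ θ) = 0}

/-- The Ronkin function: the average over `θ ∈ [0, 2π]^d` of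
`Re (log (det (E - H(e^{μ + iθ})))) = log |det (E - H(e^{μ + iθ}))|`. -/
def ronkin {d N : ℕ} (H : (Fin d → ℂ) → Matrix (Fin N) (Fin N) ℂ) (E : ℂ)
    (μ : Fin d → ℝ) : ℝ :=
  ((2 * Real.pi) ^ d)⁻¹ *
    ∫ θ in Set.Icc (0 : Fin d → ℝ) (fun _ => 2 * Real.pi),
      Real.log ‖charDet H E (expPoint μ θ)‖

/-- `U` is an amoeba central hole: a connected component of the complement of the amoeba on which
the Ronkin function is constant. -/
def IsCentralHole {d N : ℕ} (H : (Fin d → ℂ) → Matrix (Fin N) (Fin N) ℂ) (E : ℂ)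
    (U : Set (Fin d → ℝ)) : Prop :=
  (∃ μ ∈ (amoeba H E)ᶜ, U = connectedComponentIn (amoeba H E)ᶜ μ) ∧
    ∀ μ₁ ∈ U, ∀ μ₂ ∈ U, ronkin H E μ₁ = ronkin H E μ₂

/-- On `[0, 2π]` the curve `γ` never vanishes, has a continuous phase angle `φ`, and that phase
angle increases by `2π n` in total: `γ` winds `n` times around `0`. -/
def HasWindingNumber (γ : ℝ → ℂ) (n : ℤ) : Prop :=
  ∃ φ : ℝ → ℝ, ContinuousOn φ (Set.Icc 0 (2 * Real.pi)) ∧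
    (∀ t ∈ Set.Icc 0 (2 * Real.pi),
      γ t ≠ 0 ∧ γ t = (‖γ t‖ : ℂ) * Complex.exp ((φ t : ℂ) * Complex.I)) ∧
    φ (2 * Real.pi) - φ 0 = 2 * Real.pi * n

end

noncomputable section

/-! On the unit torus, `E - H` deforms through invertible matrices to the constant `i`. The segment
`p (E - H) + (1 - p) i` equals `p (E' - H)` with `E' = E + i (1 - p) / p`, and `Im E' ≥ Im E`
exceeds every imaginary part in the PBC spectrum (`segmentDet_ne_zero`). The winding number of the
determinant in each angle is an integer depending continuously on parameters. It therefore agrees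
with that of a constant, namely `0` (`logDerivPeriod_eq_zero_at_zero`).

The same rigidity (`logDerivPeriod_eq_of_isPreconnected`) carries winding number `0` from the torus
over the origin to the whole component `U` of the amoeba complement containing `0`. The `j`-th
partial derivative of the Ronkin function is the torus average of the real part of the logarithmic
derivative. Integrating over `θ_j` first gives the vanishing winding number, so the Ronkin function
has zero gradient on `U` and is constant there. -/

theorem eq_mul_exp_integral_logDeriv {γ γ' : ℝ → ℂ} (hγ : ∀ t, HasDerivAt γ (γ' t) t)
    (hγ' : Continuous γ') (h0 : ∀ t, γ t ≠ 0) (a t : ℝ) :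
    γ t = γ a * Complex.exp (∫ s in a..t, γ' s / γ s) := by
  have hc : Continuous fun s => γ' s / γ s :=
    hγ'.div (continuous_iff_continuousAt.2 fun t => (hγ t).continuousAt) h0
  have hd : ∀ t, HasDerivAt (fun t => γ t * Complex.exp (-∫ s in a..t, γ' s / γ s)) 0 t := by
    intro t
    have h1 : HasDerivAt (fun t => ∫ s in a..t, γ' s / γ s) (γ' t / γ t) t :=
      hc.integral_hasStrictDerivAt a t |>.hasDerivAt
    refine ((hγ t).fun_mul h1.fun_neg.cexp).congr_deriv ?_
    have := h0 t
    field_simp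
    ring
  have := is_const_of_deriv_eq_zero (fun t => (hd t).differentiableAt) (fun t => (hd t).deriv) t a
  simp only [intervalIntegral.integral_same, neg_zero, Complex.exp_zero, mul_one] at this
  rw [← this, mul_assoc, ← Complex.exp_add, neg_add_cancel, Complex.exp_zero, mul_one]

/-! ### Winding numbers as periods of the logarithmic derivative -/

section LogDerivative

variable {V : Type*} [NormedAddCommGroup V] [NormedSpace ℂ V]

/-- The integral over one period of the logarithmic derivative of `K` along `t ↦ x + i t v`. -/
def logDerivPeriod (K : V → ℂ) (v x : V) : ℂ :=
  ∫ t in (0 : ℝ)..(2 * Real.pi),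
    fderiv ℂ K (x + ((t : ℂ) * Complex.I) • v) v / K (x + ((t : ℂ) * Complex.I) • v)

theorem hasDerivAt_comp_imaginary_line {K : V → ℂ} (hK : ContDiff ℂ 1 K) (v x : V) (t : ℝ) :
    HasDerivAt (fun t : ℝ => K (x + ((t : ℂ) * Complex.I) • v))
      (Complex.I * fderiv ℂ K (x + ((t : ℂ) * Complex.I) • v) v) t := by
  have h1 : HasDerivAt (fun t : ℝ => x + ((t : ℂ) * Complex.I) • v) (Complex.I • v) t := by
    have := ((Complex.ofRealCLM.hasDerivAt (x := t)).mul_const Complex.I).smul_const v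
    simpa using this.const_add x
  have h2 := ((hK.differentiable one_ne_zero (x + ((t : ℂ) * Complex.I) • v)).hasFDerivAt
    |>.restrictScalars ℝ).comp_hasDerivAt t h1
  simpa [Function.comp_def] using h2

theorem continuous_fderiv_imaginary_line {K : V → ℂ} (hK : ContDiff ℂ 1 K) (v : V) :
    Continuous fun q : V × ℝ => fderiv ℂ K (q.1 + ((q.2 : ℂ) * Complex.I) • v) v :=
  ((hK.continuous_fderiv one_ne_zero).comp (by fun_prop)).clm_apply continuous_const

theorem imaginary_line_eq_mul_exp {K : V → ℂ} (hK : ContDiff ℂ 1 K) (v x : V)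
    (h0 : ∀ t : ℝ, K (x + ((t : ℂ) * Complex.I) • v) ≠ 0) (t : ℝ) :
    K (x + ((t : ℂ) * Complex.I) • v) = K x * Complex.exp (∫ s in (0 : ℝ)..t,
      Complex.I * fderiv ℂ K (x + ((s : ℂ) * Complex.I) • v) v /
        K (x + ((s : ℂ) * Complex.I) • v)) := by
  have := eq_mul_exp_integral_logDeriv (hasDerivAt_comp_imaginary_line hK v x)
    (continuous_const.mul ((continuous_fderiv_imaginary_line hK v).comp
      (Continuous.prodMk_right x))) h0 0 t
  simpa using this

/-- Periodicity of `K` forces `exp (i * period) = 1`. -/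
theorem exists_int_logDerivPeriod {K : V → ℂ} (hK : ContDiff ℂ 1 K) (v x : V)
    (h0 : ∀ t : ℝ, K (x + ((t : ℂ) * Complex.I) • v) ≠ 0)
    (hp : K (x + (((2 * Real.pi : ℝ) : ℂ) * Complex.I) • v) = K x) :
    ∃ n : ℤ, logDerivPeriod K v x = ((2 * Real.pi * n : ℝ) : ℂ) := by
  have h := imaginary_line_eq_mul_exp hK v x h0 (2 * Real.pi)
  have hx : K x ≠ 0 := by simpa using h0 0
  rw [hp, eq_comm, mul_eq_left₀ hx, Complex.exp_eq_one_iff] at h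
  obtain ⟨n, hn⟩ := h
  refine ⟨n, ?_⟩
  simp_rw [mul_div_assoc, intervalIntegral.integral_const_mul] at hn
  apply mul_left_cancel₀ Complex.I_ne_zero
  rw [logDerivPeriod, hn]
  push_cast
  ring

/-- Homotopy invariance: the period is continuous in the base point and lies in the discrete set
`2πℤ`, so it cannot vary on a preconnected set. -/
theorem logDerivPeriod_eq_of_isPreconnected {K : V → ℂ} (hK : ContDiff ℂ 1 K) (v : V) {S : Set V}
    (hS : IsPreconnected S) (h0 : ∀ x ∈ S, ∀ t : ℝ, K (x + ((t : ℂ) * Complex.I) • v) ≠ 0)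
    (hp : ∀ x ∈ S, K (x + (((2 * Real.pi : ℝ) : ℂ) * Complex.I) • v) = K x)
    {x y : V} (hx : x ∈ S) (hy : y ∈ S) : logDerivPeriod K v x = logDerivPeriod K v y := by
  have : PreconnectedSpace S := isPreconnected_iff_preconnectedSpace.1 hS
  choose n hn using fun x : S => exists_int_logDerivPeriod hK v x (h0 x x.2) (hp x x.2)
  have hc : Continuous fun x : S => logDerivPeriod K v x := by
    apply intervalIntegral.continuous_parametric_intervalIntegral_of_continuous'
    refine Continuous.div ((continuous_fderiv_imaginary_line hK v).comp
      (f := fun q : S × ℝ => ((q.1 : V), q.2)) (by fun_prop)) ?_ fun q => h0 q.1 q.1.2 q.2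
    exact hK.continuous.comp (by fun_prop)
  have hn' : Continuous n := by
    rw [Int.isClosedEmbedding_coe_real.isEmbedding.continuous_iff]
    have : (fun x : S => ((n x : ℤ) : ℝ)) =
        fun x : S => (logDerivPeriod K v x).re / (2 * Real.pi) := by
      funext x
      rw [hn x, Complex.ofReal_re]
      field_simp
    change Continuous fun x : S => ((n x : ℤ) : ℝ)
    rw [this]
    exact (Complex.continuous_re.comp hc).div_const _
  have := PreconnectedSpace.constant ‹_› hn' (x := ⟨x, hx⟩) (y := ⟨y, hy⟩)
  rw [hn ⟨x, hx⟩, hn ⟨y, hy⟩, this]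

/-- The imaginary part of the primitive `J` of the logarithmic derivative, shifted by the initial
argument, is a continuous phase. Its total increase is the imaginary part of `i` times the period.
-/
theorem hasWindingNumber_zero_of_logDerivPeriod_eq_zero {K : V → ℂ} (hK : ContDiff ℂ 1 K) (v x : V)
    (h0 : ∀ t : ℝ, K (x + ((t : ℂ) * Complex.I) • v) ≠ 0) (hW : logDerivPeriod K v x = 0) :
    HasWindingNumber (fun t : ℝ => K (x + ((t : ℂ) * Complex.I) • v)) 0 := by
  set J : ℝ → ℂ := fun t => ∫ s in (0 : ℝ)..t,
      Complex.I * fderiv ℂ K (x + ((s : ℂ) * Complex.I) • v) v /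
        K (x + ((s : ℂ) * Complex.I) • v) with hJ
  have hJc : Continuous J := by
    apply intervalIntegral.continuous_primitive
    intro a b
    apply Continuous.intervalIntegrable
    exact (continuous_const.mul ((continuous_fderiv_imaginary_line hK v).comp
      (Continuous.prodMk_right x))).div (hK.continuous.comp (by fun_prop)) h0
  have hJ0 : J 0 = 0 := by simp [hJ]
  have hJ1 : J (2 * Real.pi) = 0 := by
    simp only [hJ, mul_div_assoc, intervalIntegral.integral_const_mul]
    rw [← logDerivPeriod, hW, mul_zero]
  refine ⟨fun t => (K x).arg + (J t).im, by fun_prop, fun t _ => ⟨h0 t, ?_⟩, ?_⟩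
  · have h := imaginary_line_eq_mul_exp hK v x h0 t
    change K (x + ((t : ℂ) * Complex.I) • v) = K x * Complex.exp (J t) at h
    beta_reduce
    rw [h, norm_mul, Complex.norm_exp]
    nth_rw 1 [← Complex.norm_mul_exp_arg_mul_I (K x), ← Complex.re_add_im (J t)]
    push_cast
    rw [add_mul, Complex.exp_add, Complex.exp_add]
    ring
  · simp [hJ0, hJ1]

/-- Makes a homotopy parameter `p` an extra coordinate of the base point, so that homotopy
invariance applies to a deformation of the function itself. -/
theorem logDerivPeriod_prodMk {W : Type*} [NormedAddCommGroup W] [NormedSpace ℂ W]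
    {K : W × V → ℂ} (hK : ContDiff ℂ 1 K) (p : W) (v x : V) :
    logDerivPeriod (fun w => K (p, w)) v x = logDerivPeriod K (0, v) (p, x) := by
  have h : ∀ w, fderiv ℂ (fun w => K (p, w)) w v = fderiv ℂ K (p, w) (0, v) := fun w => by
    have h1 : HasFDerivAt (fun w : V => (p, w)) (ContinuousLinearMap.inr ℂ W V) w :=
      hasFDerivAt_prodMk_right p w
    have h2 := (hK.differentiable one_ne_zero (p, w)).hasFDerivAt.comp w h1
    rw [show (fun w => K (p, w)) = K ∘ fun w => (p, w) from rfl, h2.fderiv]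
    simp
  simp [logDerivPeriod, h]

end LogDerivative

/-! ### Torus averages and the gradient of the Ronkin integral -/

-- Fubini, with the `j`-th angle as the inner variable.
open MeasureTheory in
theorem setIntegral_Icc_eq_zero_of_intervalIntegral_update {d : ℕ} {q : (Fin d → ℝ) → ℝ}
    (hq : Continuous q) {T : ℝ} (hT : 0 ≤ T) (j : Fin d)
    (h : ∀ θ, ∫ t in (0 : ℝ)..T, q (Function.update θ j t) = 0) :
    ∫ θ in Set.Icc (0 : Fin d → ℝ) (fun _ => T), q θ = 0 := by
  obtain _ | n := d
  · exact j.elim0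
  have hpi : (volume : Measure (Fin (n + 1) → ℝ)).restrict (Set.Icc 0 fun _ => T) =
      Measure.pi fun _ => (volume : Measure ℝ).restrict (Set.Icc 0 T) := by
    rw [← Set.pi_univ_Icc, volume_pi, Measure.restrict_pi_pi]
    rfl
  have hint : Integrable q ((volume : Measure (Fin (n + 1) → ℝ)).restrict (Set.Icc 0 fun _ => T)) :=
    hq.continuousOn.integrableOn_compact isCompact_Icc
  have hmp := (measurePreserving_piFinSuccAbove
    (fun _ : Fin (n + 1) => (volume : Measure ℝ).restrict (Set.Icc 0 T)) j).symm
  rw [hpi] at hint ⊢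
  rw [← hmp.integral_comp (MeasurableEquiv.measurableEmbedding _), integral_prod_symm]
  · refine integral_eq_zero_of_ae (Filter.Eventually.of_forall fun y => ?_)
    have := h (j.insertNth 0 y)
    rw [intervalIntegral.integral_of_le hT, ← integral_Icc_eq_integral_Ioc] at this
    simpa [MeasurableEquiv.piFinSuccAbove, Fin.insertNthEquiv] using this
  · exact (hmp.integrable_comp_emb (MeasurableEquiv.measurableEmbedding _)).2 hint

/-- The point `μ + i θ` of `ℂ^d`. -/
def logPoint {d : ℕ} (μ θ : Fin d → ℝ) : Fin d → ℂ := fun i => (μ i : ℂ) + (θ i : ℂ) * Complex.I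

theorem continuous_logPoint {d : ℕ} :
    Continuous fun q : (Fin d → ℝ) × (Fin d → ℝ) => logPoint q.1 q.2 := by
  unfold logPoint
  fun_prop

theorem logPoint_update {d : ℕ} (μ θ : Fin d → ℝ) (j : Fin d) (t : ℝ) :
    logPoint μ (Function.update θ j t) =
      logPoint μ (Function.update θ j 0) + ((t : ℂ) * Complex.I) • Pi.single j 1 := by
  funext i
  obtain rfl | hi := eq_or_ne i j
  · simp [logPoint]
  · simp [logPoint, hi]

/-- The inclusion of `ℝ^d` into `ℂ^d`. -/
def ofRealPiCLM (d : ℕ) : (Fin d → ℝ) →L[ℝ] (Fin d → ℂ) :=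
  ContinuousLinearMap.pi fun i => Complex.ofRealCLM.comp (ContinuousLinearMap.proj i)

theorem ofRealPiCLM_single {d : ℕ} (j : Fin d) :
    ofRealPiCLM d (Pi.single j 1) = Pi.single j 1 := by
  funext i
  obtain rfl | hi := eq_or_ne i j
  · simp [ofRealPiCLM]
  · simp [ofRealPiCLM, hi]

/-- The derivative of `μ ↦ log |G (μ + i θ)|`. -/
def logNormDeriv {d : ℕ} (G : (Fin d → ℂ) → ℂ) (μ θ : Fin d → ℝ) : (Fin d → ℝ) →L[ℝ] ℝ :=
  Complex.reCLM.comp (((G (logPoint μ θ))⁻¹ • fderiv ℂ G (logPoint μ θ)).restrictScalars ℝ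
    |>.comp (ofRealPiCLM d))

section LogNorm

variable {d : ℕ} {G : (Fin d → ℂ) → ℂ}

theorem logNormDeriv_single (μ θ : Fin d → ℝ) (j : Fin d) :
    logNormDeriv G μ θ (Pi.single j 1) =
      (fderiv ℂ G (logPoint μ θ) (Pi.single j 1) / G (logPoint μ θ)).re := by
  simp [logNormDeriv, ofRealPiCLM_single, div_eq_inv_mul]

theorem continuousOn_logNormDeriv (hG : ContDiff ℂ 1 G) {Ω : Set (Fin d → ℝ)}
    (h0 : ∀ μ ∈ Ω, ∀ θ, G (logPoint μ θ) ≠ 0) :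
    ContinuousOn (fun q : (Fin d → ℝ) × (Fin d → ℝ) => logNormDeriv G q.1 q.2)
      (Ω ×ˢ Set.univ) := by
  unfold logNormDeriv
  refine continuousOn_const.clm_comp (ContinuousOn.clm_comp ?_ continuousOn_const)
  refine (ContinuousLinearMap.continuous_restrictScalars (𝕜 := ℂ) (𝕜' := ℝ)).comp_continuousOn ?_
  refine ContinuousOn.smul (ContinuousOn.inv₀ (f := fun q : (Fin d → ℝ) × (Fin d → ℝ) =>
    G (logPoint q.1 q.2)) ?_ fun q hq => h0 q.1 hq.1 q.2) ?_
  · exact (hG.continuous.comp continuous_logPoint).continuousOn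
  · exact ((hG.continuous_fderiv one_ne_zero).comp continuous_logPoint).continuousOn

theorem continuous_logNormDeriv (hG : ContDiff ℂ 1 G) {μ : Fin d → ℝ}
    (h0 : ∀ θ, G (logPoint μ θ) ≠ 0) : Continuous fun θ => logNormDeriv G μ θ := by
  have h := continuousOn_logNormDeriv hG (Ω := {μ}) (by simpa using h0)
  exact h.comp_continuous (f := fun θ => (μ, θ)) (by fun_prop) fun θ => ⟨rfl, trivial⟩

theorem hasFDerivAt_log_norm_logPoint (hG : ContDiff ℂ 1 G) {μ : Fin d → ℝ} (θ : Fin d → ℝ)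
    (h0 : G (logPoint μ θ) ≠ 0) :
    HasFDerivAt (fun μ => Real.log ‖G (logPoint μ θ)‖) (logNormDeriv G μ θ) μ := by
  have h1 : HasFDerivAt (fun μ => logPoint μ θ) (ofRealPiCLM d) μ := by
    have := (ofRealPiCLM d).hasFDerivAt (x := μ) |>.add_const (fun i => (θ i : ℂ) * Complex.I)
    exact this
  have h2 : HasFDerivAt (fun μ => G (logPoint μ θ))
      (((fderiv ℂ G (logPoint μ θ)).restrictScalars ℝ).comp (ofRealPiCLM d)) μ :=
    ((hG.differentiable one_ne_zero (logPoint μ θ)).hasFDerivAt.restrictScalars ℝ).comp μ h1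
  -- Dividing by the value at `μ` puts the argument of the logarithm at `1`, away from the branch
  -- cut; `h4` adds the lost constant back.
  have h3 : HasFDerivAt (fun ν => Complex.log ((G (logPoint μ θ))⁻¹ • G (logPoint ν θ))) _ μ :=
    ((Complex.hasStrictDerivAt_log (by simp [h0])).hasStrictFDerivAt.hasFDerivAt.restrictScalars
      ℝ).comp μ (h2.fun_const_smul (G (logPoint μ θ))⁻¹)
  have h4 := (Complex.reCLM.hasFDerivAt.comp μ h3).add_const (Real.log ‖G (logPoint μ θ)‖)
  refine (h4.congr_fderiv ?_).congr_of_eventuallyEq ?_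
  · ext v
    simp [logNormDeriv, h0]
  · filter_upwards [h2.continuousAt.eventually_ne h0] with ν hν
    simp [Complex.log_re, Real.log_mul, h0, hν]

-- Differentiation under the integral sign: the derivative is bounded on the compact product of a
-- closed ball inside `Ω` with the box of angles.
open MeasureTheory in
theorem hasFDerivAt_integral_log_norm (hG : ContDiff ℂ 1 G) {Ω : Set (Fin d → ℝ)} (hΩ : IsOpen Ω)
    (h0 : ∀ μ ∈ Ω, ∀ θ, G (logPoint μ θ) ≠ 0) {μ : Fin d → ℝ} (hμ : μ ∈ Ω) (T : Fin d → ℝ) :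
    Integrable (logNormDeriv G μ) (volume.restrict (Set.Icc 0 T)) ∧
    HasFDerivAt (fun μ => ∫ θ in Set.Icc 0 T, Real.log ‖G (logPoint μ θ)‖)
      (∫ θ in Set.Icc 0 T, logNormDeriv G μ θ) μ := by
  obtain ⟨ε, hε, hball⟩ := Metric.nhds_basis_closedBall.mem_iff.1 (hΩ.mem_nhds hμ)
  have hcD := continuousOn_logNormDeriv hG h0
  have hcD' := continuous_logNormDeriv hG (h0 μ hμ)
  have hcF : ∀ ν ∈ Ω, Continuous fun θ => Real.log ‖G (logPoint ν θ)‖ := fun ν hν =>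
    (hG.continuous.comp (continuous_logPoint.comp (Continuous.prodMk_right ν))).norm.log
      fun θ => norm_ne_zero_iff.2 (h0 ν hν θ)
  obtain ⟨C, hC⟩ := ((isCompact_closedBall μ ε).prod (isCompact_Icc (a := (0 : Fin d → ℝ)) (b := T))
    |>.exists_bound_of_continuousOn (hcD.mono (Set.prod_mono hball (Set.subset_univ _))))
  refine ⟨hcD'.continuousOn.integrableOn_compact isCompact_Icc, ?_⟩
  refine hasFDerivAt_integral_of_dominated_of_fderiv_le (bound := fun _ => C)
    (Metric.closedBall_mem_nhds μ hε) ?_ ?_ ?_ ?_ ?_ ?_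
  · filter_upwards [hΩ.mem_nhds hμ] with ν hν using (hcF ν hν).aestronglyMeasurable
  · exact (hcF μ hμ).continuousOn.integrableOn_compact isCompact_Icc
  · exact hcD'.aestronglyMeasurable
  · exact (ae_restrict_iff' measurableSet_Icc).2
      (Filter.Eventually.of_forall fun θ hθ ν hν => hC (ν, θ) ⟨hν, hθ⟩)
  · exact continuousOn_const.integrableOn_compact isCompact_Icc
  · exact Filter.Eventually.of_forall fun θ ν hν =>
      hasFDerivAt_log_norm_logPoint hG θ (h0 ν (hball hν) θ)

-- The integral of the `j`-th component over `θ_j` alone is already zero, being the real part of a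
-- vanishing period.
open MeasureTheory in
theorem integral_logNormDeriv_eq_zero (hG : ContDiff ℂ 1 G) {μ : Fin d → ℝ}
    (h0 : ∀ θ, G (logPoint μ θ) ≠ 0)
    (hint : Integrable (logNormDeriv G μ)
      (volume.restrict (Set.Icc (0 : Fin d → ℝ) fun _ => 2 * Real.pi)))
    (hW : ∀ j θ, logDerivPeriod G (Pi.single j 1) (logPoint μ θ) = 0) :
    ∫ θ in Set.Icc (0 : Fin d → ℝ) (fun _ => 2 * Real.pi), logNormDeriv G μ θ = 0 := by
  have hc := continuous_logNormDeriv hG h0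
  have key : ∀ j, (∫ θ in Set.Icc (0 : Fin d → ℝ) (fun _ => 2 * Real.pi), logNormDeriv G μ θ)
      (Pi.single j 1) = 0 := by
    intro j
    rw [ContinuousLinearMap.integral_apply hint]
    refine setIntegral_Icc_eq_zero_of_intervalIntegral_update (hc.clm_apply continuous_const)
      Real.two_pi_pos.le j fun θ => ?_
    have hcq : Continuous fun t : ℝ =>
        fderiv ℂ G (logPoint μ (Function.update θ j t)) (Pi.single j 1) /
          G (logPoint μ (Function.update θ j t)) := by
      have hl : Continuous fun t : ℝ => logPoint μ (Function.update θ j t) :=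
        continuous_logPoint.comp ((continuous_const).prodMk
          ((continuous_const (y := θ)).update j continuous_id))
      exact (((hG.continuous_fderiv one_ne_zero).comp hl).clm_apply continuous_const).div
        (hG.continuous.comp hl) fun t => h0 _
    -- The base point has its `j`-th angle reset to `0`, so that the imaginary line from it runs
    -- exactly through the points `Function.update θ j t`.
    have h := congrArg Complex.re (hW j (Function.update θ j 0))
    simp only [logDerivPeriod, ← logPoint_update] at h
    have h' := Complex.reCLM.intervalIntegral_comp_comm
      (hcq.intervalIntegrable (μ := volume) 0 (2 * Real.pi))
    simp only [logNormDeriv_single]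
    exact h'.trans h
  apply ContinuousLinearMap.coe_injective
  refine LinearMap.pi_ext' fun j => LinearMap.ext_ring ?_
  simpa using key j

end LogNorm

/-! ### Bloch Hamiltonians: spectrum, amoeba and the deformation to a constant -/

section Bloch

variable {d N : ℕ} {H : (Fin d → ℂ) → Matrix (Fin N) (Fin N) ℂ}

theorem IsBlochHamiltonian.continuous_comp (hH : IsBlochHamiltonian H) {X : Type*}
    [TopologicalSpace X] {z : X → Fin d → ℂ} (hz : Continuous z) (hz0 : ∀ x i, z x i ≠ 0) :
    Continuous fun x => H (z x) :=
  continuous_matrix fun a b => (hH a b).continuousOn.comp_continuous hz hz0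

theorem IsBlochHamiltonian.continuous_charDet (hH : IsBlochHamiltonian H) {X : Type*}
    [TopologicalSpace X] {e : X → ℂ} {z : X → Fin d → ℂ} (he : Continuous e) (hz : Continuous z)
    (hz0 : ∀ x i, z x i ≠ 0) : Continuous fun x => charDet H (e x) (z x) :=
  ((he.smul continuous_const).sub (hH.continuous_comp hz hz0)).matrix_det

theorem charDet_eq_zero_iff {E : ℂ} {z : Fin d → ℂ} :
    charDet H E z = 0 ↔ E ∈ spectrum ℂ (H z) := by
  rw [spectrum.mem_iff, Matrix.isUnit_iff_isUnit_det, isUnit_iff_ne_zero, not_not, charDet,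
    Algebra.algebraMap_eq_smul_one]

theorem continuous_circle_point :
    Continuous fun u : Fin d → Circle => fun i => (u i : ℂ) := by fun_prop

theorem pbcSpectrum_eq_image :
    pbcSpectrum H = Prod.fst '' {q : ℂ × (Fin d → Circle) | charDet H q.1 (fun i => q.2 i) = 0} := by
  ext E
  constructor
  · rintro ⟨z, hz, h⟩
    exact ⟨(E, fun i => ⟨z i, mem_sphere_zero_iff_norm.2 (hz i)⟩), h, rfl⟩
  · rintro ⟨q, hq, rfl⟩
    exact ⟨fun i => q.2 i, fun i => Circle.norm_coe _, hq⟩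

-- Closed as a projection along a compact torus; bounded because eigenvalues are at most the
-- operator norm, which is bounded on that torus.
attribute [local instance] Matrix.linftyOpNormedRing Matrix.linftyOpNormedAlgebra in
theorem IsBlochHamiltonian.isCompact_pbcSpectrum (hH : IsBlochHamiltonian H) (hN : 0 < N) :
    IsCompact (pbcSpectrum H) := by
  have : Nonempty (Fin N) := ⟨⟨0, hN⟩⟩
  refine Metric.isCompact_of_isClosed_isBounded ?_ ?_
  · rw [pbcSpectrum_eq_image]
    refine isClosedMap_fst_of_compactSpace _ (isClosed_eq ?_ continuous_const)
    exact hH.continuous_charDet continuous_fst (continuous_circle_point.comp continuous_snd)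
      fun x i => Circle.coe_ne_zero _
  · obtain ⟨C, hC⟩ := isCompact_univ.exists_bound_of_continuousOn
      (hH.continuous_comp (continuous_circle_point (d := d))
        fun x i => Circle.coe_ne_zero _).continuousOn
    refine isBounded_iff_forall_norm_le.2 ⟨C, ?_⟩
    rw [pbcSpectrum_eq_image]
    rintro _ ⟨q, hq, rfl⟩
    have : NormOneClass (Matrix (Fin N) (Fin N) ℂ) := Matrix.linfty_opNormOneClass
    exact (spectrum.norm_le_norm_of_mem (charDet_eq_zero_iff.1 hq)).trans (hC q.2 trivial)

theorem pbcSpectrum_nonempty (hN : 0 < N) : (pbcSpectrum H).Nonempty := by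
  have : Nonempty (Fin N) := ⟨⟨0, hN⟩⟩
  obtain ⟨E, hE⟩ := spectrum.nonempty_of_isAlgClosed_of_finiteDimensional ℂ (H fun _ => 1)
  exact ⟨E, fun _ => 1, by simp, charDet_eq_zero_iff.2 hE⟩

/-- Replacing real angles by points of the circle makes the projected fibre compact, which yields
closedness of the amoeba. -/
theorem amoeba_eq_image (E : ℂ) :
    amoeba H E = Prod.fst '' {q : (Fin d → ℝ) × (Fin d → Circle) |
      charDet H E (fun i => Complex.exp (q.1 i) * q.2 i) = 0} := by
  ext μ
  constructor
  · rintro ⟨θ, h⟩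
    refine ⟨(μ, fun i => Circle.exp (θ i)), ?_, rfl⟩
    unfold expPoint at h
    simpa [Complex.exp_add] using h
  · rintro ⟨⟨μ, u⟩, hq, rfl⟩
    refine ⟨fun i => (u i : ℂ).arg, ?_⟩
    unfold expPoint
    simpa [Complex.exp_add, ← Circle.coe_exp] using hq

theorem IsBlochHamiltonian.isClosed_amoeba (hH : IsBlochHamiltonian H) (E : ℂ) :
    IsClosed (amoeba H E) := by
  rw [amoeba_eq_image]
  refine isClosedMap_fst_of_compactSpace _ (isClosed_eq ?_ continuous_const)
  exact hH.continuous_charDet continuous_const (by fun_prop)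
    fun x i => mul_ne_zero (Complex.exp_ne_zero _) (Circle.coe_ne_zero _)

/-- The determinant of the segment from `i` (at `p = 0`) to `E - H` (at `p = 1`), in logarithmic
coordinates. -/
def segmentDet (H : (Fin d → ℂ) → Matrix (Fin N) (Fin N) ℂ) (E : ℂ) (q : ℂ × (Fin d → ℂ)) : ℂ :=
  (q.1 • (E • (1 : Matrix (Fin N) (Fin N) ℂ) - H fun i => Complex.exp (q.2 i)) +
    ((1 - q.1) * Complex.I) • (1 : Matrix (Fin N) (Fin N) ℂ)).det

/-- Since `exp` never vanishes, logarithmic coordinates turn analyticity on `(ℂ \ {0})^d` into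
smoothness on a whole vector space. -/
theorem IsBlochHamiltonian.contDiff_segmentDet (hH : IsBlochHamiltonian H) (E : ℂ) :
    ContDiff ℂ 1 (segmentDet H E) := by
  unfold segmentDet
  simp_rw [Matrix.det_apply]
  have hentry : ∀ a b, ContDiff ℂ 1 fun q : ℂ × (Fin d → ℂ) =>
      H (fun i => Complex.exp (q.2 i)) a b := fun a b => by
    have h1 : ContDiffOn ℂ 1 (fun z => H z a b) {z | ∀ i, z i ≠ 0} :=
      (hH a b).contDiffOn_of_completeSpace
    refine h1.comp_contDiff (f := fun q : ℂ × (Fin d → ℂ) => fun i => Complex.exp (q.2 i))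
      (contDiff_pi.2 fun i => ?_) fun q i => Complex.exp_ne_zero _
    exact Complex.contDiff_exp.comp ((contDiff_apply ℂ ℂ i).comp contDiff_snd)
  refine ContDiff.sum fun σ _ => ContDiff.const_smul _ (contDiff_prod fun i _ => ?_)
  simp only [Matrix.add_apply, Matrix.smul_apply, Matrix.sub_apply, smul_eq_mul]
  exact (contDiff_fst.mul (contDiff_const.sub (hentry _ _))).add
    (((contDiff_const.sub contDiff_fst).mul contDiff_const).mul contDiff_const)

theorem segmentDet_one (E : ℂ) (μ θ : Fin d → ℝ) :
    segmentDet H E (1, logPoint μ θ) = charDet H E (expPoint μ θ) := by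
  simp only [segmentDet, sub_self, zero_mul, zero_smul, add_zero, one_smul]
  rfl

theorem segmentDet_add_two_pi (E p : ℂ) (w : Fin d → ℂ) (j : Fin d) :
    segmentDet H E (p, w + (((2 * Real.pi : ℝ) : ℂ) * Complex.I) • Pi.single j 1) =
      segmentDet H E (p, w) := by
  have : (fun i => Complex.exp ((w + (((2 * Real.pi : ℝ) : ℂ) * Complex.I) •
      (Pi.single j 1 : Fin d → ℂ)) i)) = fun i => Complex.exp (w i) := by
    funext i
    obtain rfl | hi := eq_or_ne i j
    · simp [Complex.exp_add]
    · simp [hi]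
  simp only [segmentDet]
  rw [this]

/-- For `p > 0`, factoring out `p` leaves the characteristic matrix at an energy no lower in
imaginary part than `E`, hence off the spectrum. At `p = 0` the matrix is `i` times the identity. -/
theorem segmentDet_ne_zero {E : ℂ} {M : ℝ} (hM : ∀ E' ∈ pbcSpectrum H, E'.im ≤ M)
    (hE : M < E.im) {p : ℝ} (hp : p ∈ Set.Icc (0 : ℝ) 1) (θ : Fin d → ℝ) :
    segmentDet H E (p, logPoint 0 θ) ≠ 0 := by
  obtain hp0 | hp0 := hp.1.eq_or_lt
  · simp [segmentDet, ← hp0]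
  have hpC : (p : ℂ) ≠ 0 := by exact_mod_cast hp0.ne'
  set E' : ℂ := E + (((1 - p) / p : ℝ) : ℂ) * Complex.I with hE'
  have h : segmentDet H E (p, logPoint 0 θ) = (p : ℂ) ^ N * charDet H E' (expPoint 0 θ) := by
    have hN : (p : ℂ) ^ N = (p : ℂ) ^ Fintype.card (Fin N) := by simp
    rw [charDet, hN, ← Matrix.det_smul, segmentDet]
    congr 1
    rw [hE', add_smul, add_sub_right_comm, smul_add (p : ℂ) _ (_ • _), smul_smul]
    congr 2
    push_cast
    field_simp
  rw [h]
  refine mul_ne_zero (pow_ne_zero _ hpC) fun h0 => ?_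
  have h1 := hM E' ⟨expPoint 0 θ, fun i => by simp [expPoint, Complex.norm_exp], h0⟩
  have h2 : E'.im = E.im + (1 - p) / p := by simp [hE']
  have h3 : 0 ≤ (1 - p) / p := div_nonneg (by linarith [hp.2]) hp0.le
  linarith

theorem isPreconnected_image_logPoint {U : Set (Fin d → ℝ)} (hU : IsPreconnected U) :
    IsPreconnected ((fun q : (Fin d → ℝ) × (Fin d → ℝ) => logPoint q.1 q.2) '' (U ×ˢ Set.univ)) :=
  (hU.prod isPreconnected_univ).image _ continuous_logPoint.continuousOn

theorem logPoint_add (μ θ : Fin d → ℝ) (j : Fin d) (t : ℝ) :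
    logPoint μ θ + ((t : ℂ) * Complex.I) • Pi.single j 1 =
      logPoint μ (Function.update θ j (θ j + t)) := by
  funext i
  obtain rfl | hi := eq_or_ne i j
  · simp [logPoint, add_mul, add_assoc]
  · simp [logPoint, hi]

theorem IsBlochHamiltonian.logDerivPeriod_eq_zero_at_zero (hH : IsBlochHamiltonian H)
    {E : ℂ} {M : ℝ} (hM : ∀ E' ∈ pbcSpectrum H, E'.im ≤ M) (hE : M < E.im) (j : Fin d) (θ : Fin d → ℝ) :
    logDerivPeriod (fun w => segmentDet H E (1, w)) (Pi.single j 1) (logPoint 0 θ) = 0 := by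
  have hK := hH.contDiff_segmentDet E
  have hS : IsPreconnected ((fun p : ℝ => ((p : ℂ), logPoint 0 θ)) '' Set.Icc 0 1) :=
    isPreconnected_Icc.image _ (by fun_prop)
  have h := logDerivPeriod_eq_of_isPreconnected hK (0, Pi.single j 1) hS
    (x := (1, logPoint 0 θ)) (y := (0, logPoint 0 θ)) ?_ ?_
    ⟨1, by simp, by simp⟩ ⟨0, by simp, by simp⟩
  · rw [logDerivPeriod_prodMk hK, h, ← logDerivPeriod_prodMk hK]
    -- At `p = 0` the determinant is constant in `w`, so its derivative vanishes.
    simp [logDerivPeriod, segmentDet]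
  · rintro _ ⟨p, hp, rfl⟩ t
    simpa [logPoint_add] using segmentDet_ne_zero hM hE hp (Function.update θ j (θ j + t))
  · rintro _ ⟨p, hp, rfl⟩
    simpa using segmentDet_add_two_pi (H := H) E p (logPoint 0 θ) j

end Bloch
end

/-! ### The central hole containing the origin -/

theorem mainTheorem8 {d N : ℕ} (hN : 0 < N)
    (H : (Fin d → ℂ) → Matrix (Fin N) (Fin N) ℂ) (hH : IsBlochHamiltonian H) :
    ∃ M : ℝ, IsGreatest (Complex.im '' pbcSpectrum H) M ∧
      ∀ E : ℂ, M < E.im →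
        (∃ U : Set (Fin d → ℝ), IsCentralHole H E U ∧ (0 : Fin d → ℝ) ∈ U) ∧
        HasFDerivAt (ronkin H E) (0 : (Fin d → ℝ) →L[ℝ] ℝ) 0 ∧
        ∀ (j : Fin d) (θ : Fin d → ℝ),
          HasWindingNumber
            (fun t : ℝ => charDet H E (expPoint 0 (Function.update θ j t))) 0 := by
  obtain ⟨M, hM⟩ := ((hH.isCompact_pbcSpectrum hN).image Complex.continuous_im).exists_isGreatest
    ((pbcSpectrum_nonempty hN).image _)
  refine ⟨M, hM, fun E hE => ?_⟩
  have hM' : ∀ E' ∈ pbcSpectrum H, E'.im ≤ M := fun E' h => hM.2 ⟨E', h, rfl⟩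
  set G : (Fin d → ℂ) → ℂ := fun w => segmentDet H E (1, w) with hGdef
  have hG : ContDiff ℂ 1 G := (hH.contDiff_segmentDet E).comp (contDiff_prodMk_right 1)
  have hGc : ∀ μ θ, G (logPoint μ θ) = charDet H E (expPoint μ θ) := segmentDet_one E
  have h0 : ∀ μ ∈ (amoeba H E)ᶜ, ∀ θ, G (logPoint μ θ) ≠ 0 := fun μ hμ θ h =>
    hμ ⟨θ, (hGc μ θ) ▸ h⟩
  have hΩ : IsOpen (amoeba H E)ᶜ := (hH.isClosed_amoeba E).isOpen_compl
  have hzero : (0 : Fin d → ℝ) ∈ (amoeba H E)ᶜ := by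
    rintro ⟨θ, h⟩
    refine segmentDet_ne_zero hM' hE (p := 1) (by simp) θ ?_
    rw [Complex.ofReal_one, segmentDet_one, h]
  set U := connectedComponentIn (amoeba H E)ᶜ 0 with hU
  have hUΩ : U ⊆ (amoeba H E)ᶜ := connectedComponentIn_subset _ _
  have hUzero : (0 : Fin d → ℝ) ∈ U := mem_connectedComponentIn hzero
  have hUc : IsPreconnected U := isPreconnected_connectedComponentIn
  have hW : ∀ μ ∈ U, ∀ j θ, logDerivPeriod G (Pi.single j 1) (logPoint μ θ) = 0 := by
    intro μ hμ j θ
    rw [← hH.logDerivPeriod_eq_zero_at_zero hM' hE j θ]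
    -- The set of all `μ + i θ` with `μ ∈ U` is preconnected and free of zeros of `G`, so the period
    -- at `μ` equals the one over the origin.
    refine logDerivPeriod_eq_of_isPreconnected hG _ (isPreconnected_image_logPoint hUc) ?_ ?_
      ⟨(μ, θ), ⟨hμ, trivial⟩, rfl⟩ ⟨(0, θ), ⟨hUzero, trivial⟩, rfl⟩
    · rintro _ ⟨⟨ν, η⟩, hν, rfl⟩ t
      rw [logPoint_add]
      exact h0 ν (hUΩ hν.1) _
    · rintro _ ⟨⟨ν, η⟩, -, rfl⟩
      exact segmentDet_add_two_pi E 1 _ j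
  have hR : ∀ μ ∈ U, HasFDerivAt (ronkin H E) (0 : (Fin d → ℝ) →L[ℝ] ℝ) μ := by
    intro μ hμ
    obtain ⟨hint, hder⟩ := hasFDerivAt_integral_log_norm hG hΩ h0 (hUΩ hμ) fun _ => 2 * Real.pi
    rw [integral_logNormDeriv_eq_zero hG (h0 μ (hUΩ hμ)) hint (hW μ hμ)] at hder
    simp only [hGc] at hder
    exact (hder.const_mul ((2 * Real.pi) ^ d)⁻¹).congr_fderiv (smul_zero _)
  refine ⟨⟨U, ⟨⟨0, hzero, rfl⟩, fun μ₁ h₁ μ₂ h₂ => ?_⟩, hUzero⟩, hR 0 hUzero, fun j θ => ?_⟩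
  · exact (hΩ.connectedComponentIn).is_const_of_fderiv_eq_zero hUc
      (fun μ hμ => (hR μ hμ).differentiableAt.differentiableWithinAt)
      (fun μ hμ => (hR μ hμ).fderiv) h₁ h₂
  · have h := hasWindingNumber_zero_of_logDerivPeriod_eq_zero hG (Pi.single j 1)
      (logPoint 0 (Function.update θ j 0)) ?_ (hW 0 hUzero j _)
    · simpa only [← logPoint_update, hGc] using h
    · intro t
      rw [← logPoint_update]
      exact h0 0 hzero _
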